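/- Let $(M,g)$ be a smooth four-dimensional manifold with a metric of neutral signature $(2,2)$ and Levi-Civita connection $\nabla$, and let $Z_{[\pi]}$, $W_{[\lambda]}$ be a distribution of $\alpha$-planes and a distribution of $\beta$-planes on $M$. That is, locally $T_xM\cong S_x\otimes S'_x$ with $g_{ab}=\varepsilon_{AB}\varepsilon_{A'B'}$, where $S,S'$ are the real two-dimensional bundles of unprimed and primed spinors, and $Z_{[\pi]}=\{\mu^A\pi^{A'}:\mu\in S\}$, $W_{[\lambda]}=\{\lambda^A\nu^{A'}:\nu\in S'\}$ for smooth nowhere vanishing spinor fields $\pi^{A'}$, $\lambda^A$. Such $\pi^{A'}$ and $\lambda^A$ are called local scaled representatives (LSRs) of $[\pi^{A'}]$ and $[\lambda^A]$. Put $\mathcal D=Z_{[\pi]}\cap W_{[\lambda]}=\langle\lambda^A\pi^{A'}\rangle$ and $\mathcal H=\mathcal D^\perp$. A distribution is integrable (in the sense of Frobenius) if its sections are closed under the Lie bracket, parallel if $\nabla_XY$ is a section of it for every section $Y$ of it and every vector field $X$, and auto-parallel if $\nabla_XY$ is a section of it for all sections $X,Y$ of it; sections are smooth and local. For an LSR $\lambda^A$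 put $\tilde S_b=\lambda_A\nabla_b\lambda^A$. Suppose that $(M,g,[\pi^{A'}])$ is a Walker geometry, i.e. that $Z_{[\pi]}$ is parallel. (1) $W_{[\lambda]}$ and $\mathcal H$ are both integrable if and only if $\tilde S_b\propto\lambda_B\pi_{B'}$ for LSRs $\pi^{A'}$, $\lambda^A$, i.e. $\tilde S_b=f\lambda_B\pi_{B'}$ with a function $f$, which may have zeros. (This holds over the domain of any given pair of LSRs, and over $M$ with the condition imposed on a family of pairs of LSRs whose domains cover $M$.) Suppose from now on that $W_{[\lambda]}$ is integrable (a sesquiWalker $\alpha\beta$-geometry). (2) For each pair of LSRs there is a smooth spinor field $\kappa_{B'}$ with $\tilde S_b=\lambda_B\kappa_{B'}$, and $\mathcal H$ is integrable if and only if $\pi^{B'}\kappa_{B'}=0$, i.e. $\kappa^{A'}$ is a smooth multiple $f\pi^{A'}$ of $\pi^{A'}$ (where $\kappa^{A'}$ has no zeros: if and only if $\kappa^{A'}$ is an LSR of $[\pi^{A'}]$). As in (1), this holds over the domain of any pair of LSRs and over the union of any family of such domains. (3) If $\mathcal H$ is integrable, then over the domain of any pair of LSRs $\pi^{A'}$,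 $\lambda^A$ on which $\tilde S_b$ has no zeros: keeping $\lambda^A$, there is an LSR $\hat\pi^{A'}$ of $[\pi^{A'}]$ with $\lambda_A\nabla_b\lambda^A=\lambda_B\hat\pi_{B'}$; and keeping $\pi^{A'}$, there is an LSR $\hat\lambda^A$ of $[\lambda^A]$ with $\hat\lambda_A\nabla_b\hat\lambda^A=\hat\lambda_B\pi_{B'}$. (4) $\mathcal H$ is integrable if and only if it is auto-parallel, on $M$ and on each open subset of $M$. -/

import Mathlib

open scoped Manifold ContDiff

noncomputable section

namespace AlphaBeta

/-- The model space of four-dimensional manifolds. -/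
abbrev E4 : Type := EuclideanSpace ℝ (Fin 4)

variable {M : Type*} [TopologicalSpace M] [ChartedSpace E4 M]

/-- A (not necessarily continuous) vector field on `M`. It is used as a local vector field on an
open set `U` by imposing `SmoothVF X U`; its values off `U` are irrelevant. -/
abbrev VF (M : Type*) [TopologicalSpace M] [ChartedSpace E4 M] : Type _ :=
  (x : M) → TangentSpace (𝓡 4) x

/-- The function `f` (with values in a normed space) is smooth on `U`. -/
def SmoothFn {F : Type*} [NormedAddCommGroup F] [NormedSpace ℝ F] (f : M → F) (U : Set M) : Prop :=
  ContMDiffOn (𝓡 4) 𝓘(ℝ, F) ∞ f U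

/-- The derivative `X f` of a scalar function along a vector field, at `x`. -/
def dirDeriv (X : VF M) (f : M → ℝ) (x : M) : ℝ :=
  mfderiv (𝓡 4) 𝓘(ℝ, ℝ) f x (X x)

/-- The vector field `X` is smooth on `U`. -/
def SmoothVF [IsManifold (𝓡 4) ∞ M] (X : VF M) (U : Set M) : Prop :=
  ContMDiffOn (𝓡 4) (𝓡 4).tangent ∞ (fun x => (⟨x, X x⟩ : TangentBundle (𝓡 4) M)) U

/-- A smooth metric of neutral signature `(+,+,-,-)` on a four-manifold. -/
structure NeutralMetric (M : Type*) [TopologicalSpace M] [ChartedSpace E4 M]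
    [IsManifold (𝓡 4) ∞ M] where
  /-- The scalar product on each tangent space. -/
  inner (x : M) : TangentSpace (𝓡 4) x →L[ℝ] TangentSpace (𝓡 4) x →L[ℝ] ℝ
  symm (x : M) (v w : TangentSpace (𝓡 4) x) : inner x v w = inner x w v
  /-- Every tangent space has an orthonormal basis with squared norms `1, 1, -1, -1`. -/
  neutral (x : M) : ∃ b : Module.Basis (Fin 4) ℝ (TangentSpace (𝓡 4) x),
    ∀ i j, inner x (b i) (b j) = if i = j then (if i < 2 then 1 else -1) else 0
  contMDiff : ContMDiff (𝓡 4) ((𝓡 4).prod 𝓘(ℝ, E4 →L[ℝ] E4 →L[ℝ] ℝ)) ∞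
    (fun x => Bundle.TotalSpace.mk' (E4 →L[ℝ] E4 →L[ℝ] ℝ) x (inner x))

section Connection

variable [IsManifold (𝓡 4) ∞ M] (g : NeutralMetric M)

/-- The metric at a point as a bilinear form. -/
def NeutralMetric.bilin (x : M) : LinearMap.BilinForm ℝ (TangentSpace (𝓡 4) x) :=
  LinearMap.mk₂ ℝ (fun v w => g.inner x v w) (by simp) (by simp) (by simp) (by simp)

theorem NeutralMetric.eq_zero_of_inner {x : M} {v : TangentSpace (𝓡 4) x}
    (h : ∀ w, g.inner x v w = 0) : v = 0 := by
  obtain ⟨b, hb⟩ := g.neutral x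
  rw [← b.sum_repr v]
  refine Finset.sum_eq_zero fun j _ => ?_
  have h1 := h (b j)
  rw [← b.sum_repr v] at h1
  simp only [map_sum, map_smul, sum_apply, smul_apply,
    hb, smul_eq_mul] at h1
  have h2 : b.repr v j = 0 := by
    simp only [mul_ite, mul_zero, Finset.sum_ite_eq', Finset.mem_univ, if_true] at h1
    split_ifs at h1 <;> linarith
  rw [h2, zero_smul]

theorem NeutralMetric.nondegenerate (x : M) : (g.bilin x).Nondegenerate := by
  constructor
  · intro v h
    exact g.eq_zero_of_inner h
  · intro v h
    refine g.eq_zero_of_inner fun w => ?_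
    rw [g.symm]
    exact h w

instance finiteDimensional_tangentSpace (x : M) :
    FiniteDimensional ℝ (TangentSpace (𝓡 4) x) :=
  inferInstanceAs (FiniteDimensional ℝ E4)

/-- The right-hand side of the Koszul formula for `2 g(∇_X Y, Z)`. -/
def koszul (X Y Z : VF M) (x : M) : ℝ :=
  dirDeriv X (fun y => g.inner y (Y y) (Z y)) x
  + dirDeriv Y (fun y => g.inner y (Z y) (X y)) x
  - dirDeriv Z (fun y => g.inner y (X y) (Y y)) x
  + g.inner x (VectorField.mlieBracket (𝓡 4) X Y x) (Z x)
  - g.inner x (VectorField.mlieBracket (𝓡 4) Y Z x) (X x)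
  + g.inner x (VectorField.mlieBracket (𝓡 4) Z X x) (Y x)

/-- The standard basis of the tangent space at `x`, from the preferred chart at `x`. -/
def stdBasis (x : M) : Module.Basis (Fin 4) ℝ (TangentSpace (𝓡 4) x) :=
  (EuclideanSpace.basisFun (Fin 4) ℝ).toBasis

/-- The Levi-Civita derivative `∇_X Y` of the metric `g`: at `x`, the vector `u` for which
`2 g(u, Z x)` is given by the Koszul formula whenever `Z` is one of the four basis vectors at `x`,
extended to a neighbourhood of `x` with constant components in the preferred chart. -/
def leviCivita (X Y : VF M) : VF M := fun x =>
  ((g.bilin x).toDual (g.nondegenerate x)).symm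
    ((stdBasis x).constr ℝ fun i =>
      koszul g X Y (FiberBundle.extend E4 (stdBasis x i)) x / 2)

end Connection

/-! ### Distributions -/

/-- A field of linear subspaces of the tangent spaces. -/
abbrev Distribution (M : Type*) [TopologicalSpace M] [ChartedSpace E4 M] : Type _ :=
  (x : M) → Submodule ℝ (TangentSpace (𝓡 4) x)

section Sections

variable [IsManifold (𝓡 4) ∞ M]

/-- `X` is a smooth section of the distribution `D` over `V`. -/
structure IsSection (D : Distribution M) (X : VF M) (V : Set M) : Prop where
  smooth : SmoothVF X V
  mem : ∀ x ∈ V, X x ∈ D x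

/-- `D` is integrable on `U` (in the sense of Frobenius): the Lie bracket of two local sections of
`D` is again a local section of `D`. -/
def IsIntegrableOn (D : Distribution M) (U : Set M) : Prop :=
  ∀ V : Set M, IsOpen V → V ⊆ U → ∀ X Y : VF M, IsSection D X V → IsSection D Y V →
    ∀ x ∈ V, VectorField.mlieBracket (𝓡 4) X Y x ∈ D x

end Sections

section Metric

variable [IsManifold (𝓡 4) ∞ M] (g : NeutralMetric M)

/-- `D` is parallel on `U`: `∇_X Y` lies in `D` for every local section `Y` of `D` and every local
vector field `X`. -/
def IsParallelOn (D : Distribution M) (U : Set M) : Prop :=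
  ∀ V : Set M, IsOpen V → V ⊆ U → ∀ X Y : VF M, SmoothVF X V → IsSection D Y V →
    ∀ x ∈ V, leviCivita g X Y x ∈ D x

/-- `D` is auto-parallel on `U`: `∇_X Y` lies in `D` for all local sections `X`, `Y` of `D`. -/
def IsAutoParallelOn (D : Distribution M) (U : Set M) : Prop :=
  ∀ V : Set M, IsOpen V → V ⊆ U → ∀ X Y : VF M, IsSection D X V → IsSection D Y V →
    ∀ x ∈ V, leviCivita g X Y x ∈ D x

/-- The pointwise orthogonal complement of a distribution. -/
def perp (D : Distribution M) : Distribution M := fun x =>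
  LinearMap.BilinForm.orthogonal (g.bilin x) (D x)

/-- The distribution `𝓗 = 𝓓^⊥`, where `𝓓 = Z ∩ W`. -/
def distH (Z W : Distribution M) : Distribution M := perp g fun x => Z x ⊓ W x

end Metric

/-! ### Two-spinors

A local spinor field is given by its pair of components in a local spin frame. -/

/-- The spinor symbol `ε_{AB} = ε^{AB}`, with `ε_{01} = 1`. -/
def eps (A B : Fin 2) : ℝ := !![0, 1; -1, 0] A B

/-- Lowering an index: `λ_B = λ^A ε_{AB}`. -/
def lower (l : Fin 2 → ℝ) (B : Fin 2) : ℝ := ∑ A, l A * eps A B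

/-- The contraction `λ_A μ^A`. -/
def contract (l m : Fin 2 → ℝ) : ℝ := ∑ A, lower l A * m A

/-- The four vector fields `e_{AA'}` attached to a pair of local spin frames. -/
abbrev Frame (M : Type*) [TopologicalSpace M] [ChartedSpace E4 M] : Type _ :=
  Fin 2 → Fin 2 → VF M

/-- The tangent vector `μ^A ν^{A'}` at `x`. -/
def Frame.vec (e : Frame M) (x : M) (m n : Fin 2 → ℝ) : TangentSpace (𝓡 4) x :=
  ∑ A, ∑ A', (m A * n A') • e A A' x

section Spin

variable [IsManifold (𝓡 4) ∞ M] (g : NeutralMetric M)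

/-- `e` is a smooth spin frame over `U`: it identifies `S ⊗ S'` with the tangent spaces so that
`g_{ab} = ε_{AB} ε_{A'B'}`. Equivalently `(e_{00'}, e_{11'}, e_{01'}, e_{10'})` is a null tetrad
`(ℓ, n, m, m̃)` with `g(ℓ, n) = 1 = -g(m, m̃)`. -/
structure IsSpinFrame (e : Frame M) (U : Set M) : Prop where
  smooth : ∀ A A', SmoothVF (e A A') U
  inner_eq : ∀ x ∈ U, ∀ A A' B B', g.inner x (e A A' x) (e B B' x) = eps A B * eps A' B'

/-- The component `v^{AA'}` of a tangent vector in the frame `e`. -/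
def Frame.comp (e : Frame M) (x : M) (v : TangentSpace (𝓡 4) x) (A A' : Fin 2) : ℝ :=
  ∑ B, ∑ B', eps A B * eps A' B' * g.inner x v (e B B' x)

/-- The connection coefficients on unprimed spinors: the derivative along `X` of the `B`-th
element of the unprimed spin frame has `A`-th component `(1/2) (∇_X e_{BA'})^{AA'}`, summed over
`A'`. This is the connection induced on `S` by the Levi-Civita connection. -/
def Frame.spinCoeff (e : Frame M) (X : VF M) (x : M) (A B : Fin 2) : ℝ :=
  (1 / 2) * ∑ A', e.comp g x (leviCivita g X (e B A') x) A A'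

/-- The covariant derivative `∇_X λ^A` of an unprimed spinor field. -/
def Frame.spinDeriv (e : Frame M) (X : VF M) (l : M → Fin 2 → ℝ) (x : M) (A : Fin 2) : ℝ :=
  dirDeriv X (fun y => l y A) x + ∑ B, e.spinCoeff g X x A B * l x B

/-- The covector `S̃_b = λ_A ∇_b λ^A`, as `S̃_{BB'}`. -/
def Frame.tildeS (e : Frame M) (l : M → Fin 2 → ℝ) (x : M) (B B' : Fin 2) : ℝ :=
  contract (l x) (e.spinDeriv g (e B B') l x)

/-- `π^{A'}` is over `U` a scaled representative of the projective primed spinor field defining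
`Z`: smooth, nowhere zero, with `Z = {μ^A π^{A'}}`. In particular `Z` consists of `α`-planes. -/
structure IsRepAlpha (e : Frame M) (U : Set M) (Z : Distribution M) (p : M → Fin 2 → ℝ) :
    Prop where
  smooth : SmoothFn p U
  ne_zero : ∀ x ∈ U, p x ≠ 0
  mem_iff : ∀ x ∈ U, ∀ v, v ∈ Z x ↔ ∃ m, v = e.vec x m (p x)

/-- `λ^A` is over `U` a scaled representative of the projective unprimed spinor field defining
`W`: smooth, nowhere zero, with `W = {λ^A ν^{A'}}`. In particular `W` consists of `β`-planes. -/
structure IsRepBeta (e : Frame M) (U : Set M) (W : Distribution M) (l : M → Fin 2 → ℝ) :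
    Prop where
  smooth : SmoothFn l U
  ne_zero : ∀ x ∈ U, l x ≠ 0
  mem_iff : ∀ x ∈ U, ∀ v, v ∈ W x ↔ ∃ n, v = e.vec x (l x) n

/-- Local scaled representatives `π^{A'}`, `λ^A` of `[π^{A'}]`, `[λ^A]` over a common open set,
in a spin frame. -/
structure ScaledReps (Z W : Distribution M) where
  dom : Set M
  isOpen_dom : IsOpen dom
  e : Frame M
  isSpinFrame : IsSpinFrame g e dom
  p : M → Fin 2 → ℝ
  isRep_p : IsRepAlpha e dom Z p
  l : M → Fin 2 → ℝ
  isRep_l : IsRepBeta e dom W l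

/-- `Z` is an `α`-distribution and `W` a `β`-distribution: around each point, both are given by
projective spinor fields. -/
def IsAlphaBetaPair (Z W : Distribution M) : Prop :=
  ∀ x : M, ∃ R : ScaledReps g Z W, x ∈ R.dom

/-- A Walker geometry `(M, g, [π])` together with a `β`-distribution `W`: the `α`-distribution `Z`
is parallel. -/
structure IsWalkerWithBeta (Z W : Distribution M) : Prop where
  pair : IsAlphaBetaPair g Z W
  parallel : IsParallelOn g Z Set.univ

/-- A sesquiWalker `αβ`-geometry: moreover `W` is integrable. -/
structure IsSesquiWalker (Z W : Distribution M) : Prop extends IsWalkerWithBeta g Z W where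
  integrable : IsIntegrableOn W Set.univ

variable {g}

/-- `κ` is the smooth primed spinor field over the domain with `λ_A ∇_b λ^A = λ_B κ_{B'}`. -/
structure ScaledReps.IsKappa {Z W : Distribution M} (R : ScaledReps g Z W)
    (k : M → Fin 2 → ℝ) : Prop where
  smooth : SmoothFn k R.dom
  eq : ∀ x ∈ R.dom, ∀ B B', R.e.tildeS g R.l x B B' = lower (R.l x) B * lower (k x) B'

end Spin

end AlphaBeta

end

/-
The connection on unprimed spinors is characterised by
`g(∇_X (λ^A ν^{A'}), λ^A ρ^{A'}) = -(λ_A ∇_X λ^A) (ν_{A'} ρ^{A'})`, so the covector `S̃` measures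
how far `W` is from being stable under `∇`. Antisymmetrising this identity in two sections of `W`
shows that `W` is integrable iff `S̃` annihilates `W`. If `Z` is parallel, pairing the bracket of a
section of `Z` and a section of `W` with `λ^A π^{A'}` shows that integrability of `𝓗` forces `S̃`
to annihilate `Z`; conversely, if `S̃` annihilates `𝓗 = Z + W`, then `𝓗` is stable under `∇_X` for
`X` in `𝓗`. Finally, `S̃` annihilates `W` iff `S̃_b = λ_B κ_{B'}`, and then it annihilates `Z` iff
`κ` is proportional to `π`.
-/

noncomputable section

namespace AlphaBeta

variable {M : Type*} [TopologicalSpace M] [ChartedSpace E4 M]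

/-! ### Derivatives along vector fields -/

/-- Differentiability at a point, with the models with corners filled in. -/
abbrev DiffAt (f : M → ℝ) (x : M) : Prop := MDifferentiableAt (𝓡 4) 𝓘(ℝ, ℝ) f x

theorem dirDeriv_eq_mvfderiv (X : VF M) (f : M → ℝ) (x : M) :
    dirDeriv X f x = mvfderiv (𝓡 4) f x (X x) := rfl

theorem dirDeriv_add_left (X X' : VF M) (f : M → ℝ) (x : M) :
    dirDeriv (X + X') f x = dirDeriv X f x + dirDeriv X' f x :=
  map_add (mvfderiv (𝓡 4) f x) _ _

theorem dirDeriv_smul_left (a : M → ℝ) (X : VF M) (f : M → ℝ) (x : M) :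
    dirDeriv (a • X) f x = a x * dirDeriv X f x :=
  map_smul (mvfderiv (𝓡 4) f x) _ _

theorem dirDeriv_add (X : VF M) {f h : M → ℝ} {x : M} (hf : DiffAt f x) (hh : DiffAt h x) :
    dirDeriv X (fun y => f y + h y) x = dirDeriv X f x + dirDeriv X h x :=
  congrArg (· (X x)) (mvfderiv_add hf hh)

theorem dirDeriv_mul (X : VF M) {f h : M → ℝ} {x : M} (hf : DiffAt f x) (hh : DiffAt h x) :
    dirDeriv X (fun y => f y * h y) x = dirDeriv X f x * h x + f x * dirDeriv X h x := by
  have hmul : dirDeriv X (f * h) x = f x * dirDeriv X h x + h x * dirDeriv X f x :=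
    congrArg (· (X x)) (mvfderiv_mul hf hh)
  linarith [show dirDeriv X (fun y => f y * h y) x = _ from hmul]

theorem dirDeriv_eq_zero_of_eventually_eq (X : VF M) {f : M → ℝ} {x : M} {c : ℝ}
    (h : ∀ᶠ y in nhds x, f y = c) : dirDeriv X f x = 0 := by
  have hf : mfderiv (𝓡 4) 𝓘(ℝ, ℝ) f x = mfderiv (𝓡 4) 𝓘(ℝ, ℝ) (fun _ => c) x :=
    Filter.EventuallyEq.mfderiv_eq h
  rw [dirDeriv, hf, mfderiv_const]
  rfl

/-! ### Smooth functions and vector fields -/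

theorem SmoothFn.mono {F : Type*} [NormedAddCommGroup F] [NormedSpace ℝ F] {f : M → F}
    {U V : Set M} (h : SmoothFn f U) (hV : V ⊆ U) : SmoothFn f V := ContMDiffOn.mono h hV

theorem smoothFn_const {F : Type*} [NormedAddCommGroup F] [NormedSpace ℝ F] (c : F) (U : Set M) :
    SmoothFn (fun _ : M => c) U := contMDiffOn_const

theorem smoothFn_pi {ι : Type*} [Fintype ι] {f : M → ι → ℝ} {U : Set M} :
    SmoothFn f U ↔ ∀ i, SmoothFn (fun x => f x i) U := contMDiffOn_pi_space

theorem SmoothFn.diffAt {f : M → ℝ} {U : Set M} (h : SmoothFn f U) (hU : IsOpen U) {x : M}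
    (hx : x ∈ U) : DiffAt f x :=
  (h.contMDiffAt (hU.mem_nhds hx)).mdifferentiableAt (by simp)

section Smooth

variable [IsManifold (𝓡 4) ∞ M]

instance isManifold_minSmoothness : IsManifold (𝓡 4) (minSmoothness ℝ 2) M := by
  simp only [minSmoothness_of_isRCLikeNormedField]
  infer_instance

/-- Differentiability of a vector field at a point, as a section of the tangent bundle. -/
abbrev DiffVF (X : VF M) (x : M) : Prop :=
  MDifferentiableAt (𝓡 4) (𝓡 4).tangent (fun y => (⟨y, X y⟩ : TangentBundle (𝓡 4) M)) x

theorem DiffVF.add {X Y : VF M} {x : M} (hX : DiffVF X x) (hY : DiffVF Y x) :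
    DiffVF (X + Y) x := mdifferentiableAt_add_section hX hY

theorem DiffVF.smul {f : M → ℝ} {X : VF M} {x : M} (hf : DiffAt f x) (hX : DiffVF X x) :
    DiffVF (f • X) x := hf.smul_section hX

theorem diffVF_extend {x : M} (v : TangentSpace (𝓡 4) x) :
    DiffVF (FiberBundle.extend E4 v) x :=
  FiberBundle.mdifferentiableAt_extend ..

theorem SmoothVF.mono {X : VF M} {U V : Set M} (h : SmoothVF X U) (hV : V ⊆ U) :
    SmoothVF X V := ContMDiffOn.mono h hV

theorem SmoothVF.diffVF {X : VF M} {U : Set M} (h : SmoothVF X U) (hU : IsOpen U) {x : M}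
    (hx : x ∈ U) : DiffVF X x :=
  (h.contMDiffAt (hU.mem_nhds hx)).mdifferentiableAt (by simp)

theorem SmoothVF.mlieBracket {X Y : VF M} {U : Set M} (hX : SmoothVF X U) (hY : SmoothVF Y U)
    (hU : IsOpen U) : SmoothVF (VectorField.mlieBracket (𝓡 4) X Y) U := by
  have : IsManifold (𝓡 4) (((⊤ : ℕ∞) : WithTop ℕ∞) + 1) M := by
    rwa [show ((⊤ : ℕ∞) : WithTop ℕ∞) + 1 = ∞ from rfl]
  exact fun x hx => (ContMDiffAt.mlieBracket_vectorField (m := ⊤) (n := ⊤)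
    (hX.contMDiffAt (hU.mem_nhds hx)) (hY.contMDiffAt (hU.mem_nhds hx))
    (by simp)).contMDiffWithinAt

theorem SmoothFn.dirDeriv {X : VF M} {f : M → ℝ} {U : Set M} (hf : SmoothFn f U)
    (hX : SmoothVF X U) (hU : IsOpen U) : SmoothFn (dirDeriv X f) U := by
  have hT : ContMDiffOn (𝓡 4) 𝓘(ℝ, ℝ).tangent ∞
      (fun x => tangentMapWithin (𝓡 4) 𝓘(ℝ, ℝ) f U ⟨x, X x⟩) U :=
    (hf.contMDiffOn_tangentMapWithin (m := ∞) (by simp) hU.uniqueMDiffOn).comp hX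
      fun x hx => hx
  refine ((contMDiff_snd_tangentBundle_modelSpace ℝ 𝓘(ℝ, ℝ)).comp_contMDiffOn hT).congr
    fun x hx => ?_
  change mfderiv (𝓡 4) 𝓘(ℝ, ℝ) f x (X x) = mfderivWithin (𝓡 4) 𝓘(ℝ, ℝ) f U x (X x)
  rw [mfderivWithin_of_isOpen hU hx]

variable (g : NeutralMetric M)

theorem SmoothVF.inner {X Y : VF M} {U : Set M} (hX : SmoothVF X U) (hY : SmoothVF Y U) :
    SmoothFn (fun y => g.inner y (X y) (Y y)) U := fun x hx =>
  (Bundle.contMDiffWithinAt_totalSpace.1 <|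
    ContMDiffWithinAt.clm_bundle_apply₂ (F₁ := E4) (F₂ := E4) (F₃ := ℝ)
      (E₃ := Bundle.Trivial M ℝ) g.contMDiff.contMDiffAt.contMDiffWithinAt (hX x hx) (hY x hx)).2

theorem DiffVF.inner {X Y : VF M} {x : M} (hX : DiffVF X x) (hY : DiffVF Y x) :
    DiffAt (fun y => g.inner y (X y) (Y y)) x :=
  ((mdifferentiableAt_totalSpace _ _).1 <|
    MDifferentiableAt.clm_bundle_apply₂ (F₁ := E4) (F₂ := E4) (F₃ := ℝ)
      (E₃ := Bundle.Trivial M ℝ) (g.contMDiff.mdifferentiableAt (by simp)) hX hY).2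

end Smooth

/-! ### The Levi-Civita connection -/

section LeviCivita

variable [IsManifold (𝓡 4) ∞ M] (g : NeutralMetric M) {X X' Y Y' Z : VF M} {f : M → ℝ} {x : M}

theorem NeutralMetric.eq_of_inner_eq {v w : TangentSpace (𝓡 4) x}
    (h : ∀ u, g.inner x v u = g.inner x w u) : v = w :=
  sub_eq_zero.1 <| g.eq_zero_of_inner fun u => by rw [map_sub, sub_apply, h u, sub_self]

theorem tensorialAt_koszul (hX : DiffVF X x) (hY : DiffVF Y x) :
    TensorialAt (𝓡 4) E4 (fun Z : VF M => koszul g X Y Z x) x where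
  smul {f Z} hf hZ := by
    have hYZ : (fun y => g.inner y (Y y) ((f • Z) y)) = fun y => f y * g.inner y (Y y) (Z y) := by
      ext y; simp
    have hZX : (fun y => g.inner y ((f • Z) y) (X y)) = fun y => f y * g.inner y (Z y) (X y) := by
      ext y; simp
    simp only [koszul, hYZ, hZX]
    rw [dirDeriv_mul X hf (hY.inner g hZ), dirDeriv_mul Y hf (DiffVF.inner g hZ hX),
      dirDeriv_smul_left, VectorField.mlieBracket_smul_right hf hZ,
      VectorField.mlieBracket_smul_left hf hZ, g.symm x (Y x) (Z x)]
    simp only [dirDeriv_eq_mvfderiv, map_add, map_smul, add_apply, smul_apply, smul_eq_mul,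
      Pi.smul_apply', neg_smul, map_neg, neg_apply]
    ring
  add {Z Z'} hZ hZ' := by
    have hYZ : (fun y => g.inner y (Y y) ((Z + Z') y)) =
        fun y => g.inner y (Y y) (Z y) + g.inner y (Y y) (Z' y) := by ext y; simp
    have hZX : (fun y => g.inner y ((Z + Z') y) (X y)) =
        fun y => g.inner y (Z y) (X y) + g.inner y (Z' y) (X y) := by ext y; simp
    simp only [koszul, hYZ, hZX]
    rw [dirDeriv_add X (hY.inner g hZ) (hY.inner g hZ'),
      dirDeriv_add Y (DiffVF.inner g hZ hX) (DiffVF.inner g hZ' hX),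
      dirDeriv_add_left, VectorField.mlieBracket_add_right hZ hZ',
      VectorField.mlieBracket_add_left hZ hZ']
    simp only [map_add, add_apply, Pi.add_apply]
    ring

theorem inner_leviCivita_stdBasis (X Y : VF M) (x : M) (i : Fin 4) :
    g.inner x (leviCivita g X Y x) (stdBasis x i) =
      koszul g X Y (FiberBundle.extend E4 (stdBasis x i)) x / 2 :=
  (LinearMap.BilinForm.apply_toDual_symm_apply (hB := g.nondegenerate x) _ (stdBasis x i)).trans
    (Module.Basis.constr_basis ..)

theorem inner_leviCivita (hX : DiffVF X x) (hY : DiffVF Y x) (hZ : DiffVF Z x) :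
    g.inner x (leviCivita g X Y x) (Z x) = koszul g X Y Z x / 2 := by
  have hT := tensorialAt_koszul g hX hY
  have hform : (g.inner x (leviCivita g X Y x) : TangentSpace (𝓡 4) x →ₗ[ℝ] ℝ) =
      (1 / 2 : ℝ) • (hT.mkHom _ x : TangentSpace (𝓡 4) x →ₗ[ℝ] ℝ) :=
    (stdBasis x).ext fun i => by
      rw [ContinuousLinearMap.coe_coe, inner_leviCivita_stdBasis, LinearMap.smul_apply,
        ContinuousLinearMap.coe_coe, hT.mkHom_apply_eq_extend, smul_eq_mul, one_div_mul_eq_div]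
  have hZx := congrArg (· (Z x)) hform
  rwa [LinearMap.smul_apply, ContinuousLinearMap.coe_coe, ContinuousLinearMap.coe_coe,
    hT.mkHom_apply hZ, smul_eq_mul, one_div_mul_eq_div] at hZx

theorem koszul_add_koszul_swap (X Y Z : VF M) (x : M) :
    koszul g X Y Z x + koszul g X Z Y x = 2 * dirDeriv X (fun y => g.inner y (Y y) (Z y)) x := by
  unfold koszul
  rw [VectorField.mlieBracket_swap_apply (V := Z) (W := Y),
    VectorField.mlieBracket_swap_apply (V := Z) (W := X),
    VectorField.mlieBracket_swap_apply (V := Y) (W := X)]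
  simp only [g.symm _ (Z _) (X _), g.symm _ (Y _) (X _), g.symm _ (Z _) (Y _), map_neg, neg_apply]
  ring

theorem koszul_sub_koszul_swap (X Y Z : VF M) (x : M) :
    koszul g X Y Z x - koszul g Y X Z x =
      2 * g.inner x (VectorField.mlieBracket (𝓡 4) X Y x) (Z x) := by
  unfold koszul
  rw [VectorField.mlieBracket_swap_apply (V := Z) (W := Y),
    VectorField.mlieBracket_swap_apply (V := Z) (W := X),
    VectorField.mlieBracket_swap_apply (V := Y) (W := X)]
  simp only [g.symm _ (Z _) (X _), g.symm _ (Y _) (X _), g.symm _ (Z _) (Y _), map_neg, neg_apply]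
  ring

theorem dirDeriv_inner (hX : DiffVF X x) (hY : DiffVF Y x) (hZ : DiffVF Z x) :
    dirDeriv X (fun y => g.inner y (Y y) (Z y)) x =
      g.inner x (leviCivita g X Y x) (Z x) + g.inner x (leviCivita g X Z x) (Y x) := by
  rw [inner_leviCivita g hX hY hZ, inner_leviCivita g hX hZ hY]
  linarith [koszul_add_koszul_swap g X Y Z x]

theorem inner_leviCivita_eq_neg (hX : DiffVF X x) (hY : DiffVF Y x) (hZ : DiffVF Z x) {c : ℝ}
    (h : ∀ᶠ y in nhds x, g.inner y (Y y) (Z y) = c) :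
    g.inner x (leviCivita g X Y x) (Z x) = -g.inner x (leviCivita g X Z x) (Y x) := by
  rw [eq_neg_iff_add_eq_zero, ← dirDeriv_inner g hX hY hZ, dirDeriv_eq_zero_of_eventually_eq X h]

theorem mlieBracket_eq_leviCivita_sub (hX : DiffVF X x) (hY : DiffVF Y x) :
    VectorField.mlieBracket (𝓡 4) X Y x = leviCivita g X Y x - leviCivita g Y X x := by
  refine g.eq_of_inner_eq fun u => ?_
  have hK := koszul_sub_koszul_swap g X Y (FiberBundle.extend E4 u) x
  have hXY := inner_leviCivita g hX hY (diffVF_extend u)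
  have hYX := inner_leviCivita g hY hX (diffVF_extend u)
  rw [FiberBundle.extend_apply_self] at hK hXY hYX
  rw [map_sub, sub_apply]
  linarith

theorem leviCivita_add_right (hX : DiffVF X x) (hY : DiffVF Y x) (hY' : DiffVF Y' x) :
    leviCivita g X (Y + Y') x = leviCivita g X Y x + leviCivita g X Y' x := by
  refine g.eq_of_inner_eq fun u => ?_
  have hu := diffVF_extend u
  have hsum := dirDeriv_inner g hX (hY.add hY') hu
  have hadd := dirDeriv_add X (hY.inner g hu) (hY'.inner g hu)
  rw [dirDeriv_inner g hX hY hu, dirDeriv_inner g hX hY' hu] at hadd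
  simp only [Pi.add_apply, map_add, add_apply, FiberBundle.extend_apply_self] at hsum hadd ⊢
  linarith

theorem leviCivita_smul_right (hX : DiffVF X x) (hf : DiffAt f x) (hY : DiffVF Y x) :
    leviCivita g X (f • Y) x = dirDeriv X f x • Y x + f x • leviCivita g X Y x := by
  refine g.eq_of_inner_eq fun u => ?_
  have hu := diffVF_extend u
  have hprod := dirDeriv_inner g hX (hY.smul hf) hu
  have hmul := dirDeriv_mul X hf (hY.inner g hu)
  rw [dirDeriv_inner g hX hY hu] at hmul
  simp only [Pi.smul_apply', map_add, map_smul, add_apply, smul_apply, smul_eq_mul,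
    FiberBundle.extend_apply_self] at hprod hmul ⊢
  linarith

theorem tensorialAt_leviCivita (hY : DiffVF Y x) :
    TensorialAt (𝓡 4) E4 (fun X : VF M => leviCivita g X Y x) x where
  smul {f X} hf hX := by
    have hfX := mlieBracket_eq_leviCivita_sub g (DiffVF.smul hf hX) hY
    rw [VectorField.mlieBracket_smul_left hf hX, mlieBracket_eq_leviCivita_sub g hX hY,
      leviCivita_smul_right g hY hf hX, ← dirDeriv_eq_mvfderiv, eq_sub_iff_add_eq] at hfX
    rw [← hfX]
    module
  add {X X'} hX hX' := by
    have hXX' := mlieBracket_eq_leviCivita_sub g (DiffVF.add hX hX') hY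
    rw [VectorField.mlieBracket_add_left hX hX', mlieBracket_eq_leviCivita_sub g hX hY,
      mlieBracket_eq_leviCivita_sub g hX' hY, leviCivita_add_right g hY hX hX',
      eq_sub_iff_add_eq] at hXX'
    rw [← hXX']
    module

theorem SmoothVF.inner_leviCivita {U : Set M} (hX : SmoothVF X U) (hY : SmoothVF Y U)
    (hZ : SmoothVF Z U) (hU : IsOpen U) :
    SmoothFn (fun x => g.inner x (leviCivita g X Y x) (Z x)) U := by
  have hK : SmoothFn (koszul g X Y Z) U :=
    (((((hY.inner g hZ).dirDeriv hX hU).add ((hZ.inner g hX).dirDeriv hY hU)).sub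
      ((hX.inner g hY).dirDeriv hZ hU)).add ((hX.mlieBracket hY hU).inner g hZ)).sub
      ((hY.mlieBracket hZ hU).inner g hX) |>.add ((hZ.mlieBracket hX hU).inner g hY)
  exact (hK.div_const 2).congr fun x hx =>
    AlphaBeta.inner_leviCivita g (hX.diffVF hU hx) (hY.diffVF hU hx) (hZ.diffVF hU hx)

end LeviCivita

/-! ### Spinor algebra -/

section SpinorAlgebra

variable (l m n : Fin 2 → ℝ)

theorem lower_zero : lower l 0 = -l 1 := by
  simp [lower, eps, Fin.sum_univ_two]

theorem lower_one : lower l 1 = l 0 := by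
  simp [lower, eps, Fin.sum_univ_two]

theorem lower_smul (c : ℝ) (B : Fin 2) : lower (c • l) B = c * lower l B := by
  fin_cases B <;> simp [lower_zero, lower_one]

theorem contract_eq : contract l m = l 0 * m 1 - l 1 * m 0 := by
  simp only [contract, Fin.sum_univ_two, lower_zero, lower_one]
  ring

theorem contract_self : contract l l = 0 := by
  rw [contract_eq]
  ring

theorem contract_swap : contract m l = -contract l m := by
  simp only [contract_eq]
  ring

theorem contract_add_right : contract l (m + n) = contract l m + contract l n := by
  simp only [contract_eq, Pi.add_apply]
  ring

theorem contract_smul_left (c : ℝ) : contract (c • l) m = c * contract l m := by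
  simp only [contract_eq, Pi.smul_apply, smul_eq_mul]
  ring

theorem contract_smul_right (c : ℝ) : contract l (c • m) = c * contract l m := by
  simp only [contract_eq, Pi.smul_apply, smul_eq_mul]
  ring

theorem eq_zero_of_forall_contract_eq_zero {l : Fin 2 → ℝ} (h : ∀ m, contract m l = 0) :
    l = 0 := by
  have h₀ := h (Pi.single 1 1)
  have h₁ := h (Pi.single 0 1)
  simp only [contract_eq, Pi.single_eq_same, Pi.single_apply, one_ne_zero, zero_ne_one] at h₀ h₁
  ext A
  fin_cases A <;> simp_all

/-- A spinor completing the nonzero spinor `λ` to a dyad, depending smoothly on `λ`. -/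
def dyadMate (A : Fin 2) : ℝ := lower l A / (l 0 ^ 2 + l 1 ^ 2)

theorem sq_add_sq_ne_zero {l : Fin 2 → ℝ} (hl : l ≠ 0) : l 0 ^ 2 + l 1 ^ 2 ≠ 0 := by
  rintro h
  refine hl (funext fun A => ?_)
  fin_cases A <;> simp only [Fin.zero_eta, Fin.mk_one, Pi.zero_apply] <;> nlinarith

theorem contract_dyadMate {l : Fin 2 → ℝ} (hl : l ≠ 0) : contract l (dyadMate l) = 1 := by
  have := sq_add_sq_ne_zero hl
  rw [contract_eq, dyadMate, dyadMate, lower_zero, lower_one]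
  field_simp
  ring

theorem dyad_expansion {l o : Fin 2 → ℝ} (h : contract l o = 1) (m : Fin 2 → ℝ) :
    m = contract m o • l + contract l m • o := by
  rw [contract_eq] at h
  ext A
  simp only [contract_eq, Pi.add_apply, Pi.smul_apply, smul_eq_mul]
  fin_cases A <;> simp only [Fin.zero_eta, Fin.mk_one]
  · linear_combination -m 0 * h
  · linear_combination -m 1 * h

theorem eq_smul_of_contract_eq_zero {l m : Fin 2 → ℝ} (hl : l ≠ 0) (h : contract l m = 0) :
    m = contract m (dyadMate l) • l := by
  simpa [h] using dyad_expansion (contract_dyadMate hl) m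

/-- The spinor `κ^A` with `κ_A = K_A`. -/
def raise (K : Fin 2 → ℝ) (A : Fin 2) : ℝ := ∑ B, eps A B * K B

theorem lower_raise (K : Fin 2 → ℝ) : lower (raise K) = K := by
  ext B
  fin_cases B <;> simp [lower, raise, eps, Fin.sum_univ_two]

theorem sum_lower_mul (l m : Fin 2 → ℝ) : ∑ A, m A * lower l A = contract l m :=
  Finset.sum_congr rfl fun _ _ => mul_comm _ _

theorem eq_lower_mul_of_sum_eq_zero {l K : Fin 2 → ℝ} (hl : l ≠ 0) (h : ∑ A, l A * K A = 0)
    (A : Fin 2) : K A = lower l A * ∑ B, dyadMate l B * K B := by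
  rw [← lower_raise K, sum_lower_mul, contract_swap, neg_eq_zero] at h
  conv_lhs => rw [← lower_raise K, eq_smul_of_contract_eq_zero hl h, lower_smul, mul_comm]
  rw [← sum_lower_mul, lower_raise]

theorem sum_mul_mul_of_antisymm {Ω : Fin 2 → Fin 2 → ℝ} (h : ∀ A B, Ω A B = -Ω B A) :
    ∑ A, ∑ B, m A * n B * Ω A B = contract m n * Ω 0 1 := by
  have h₀ := h 0 0
  have h₁ := h 1 1
  simp only [Fin.sum_univ_two, contract_eq]
  linear_combination (m 0 * n 0 / 2) * h₀ + (m 1 * n 1 / 2) * h₁ + (m 1 * n 0) * h 1 0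

end SpinorAlgebra

theorem SmoothFn.dyadMate {l : M → Fin 2 → ℝ} {U : Set M} (hl : SmoothFn l U)
    (hl0 : ∀ x ∈ U, l x ≠ 0) : SmoothFn (fun x => dyadMate (l x)) U := by
  have hlA := smoothFn_pi.1 hl
  have hN : SmoothFn (fun x => l x 0 ^ 2 + l x 1 ^ 2) U := ((hlA 0).pow 2).add ((hlA 1).pow 2)
  have hlow : ∀ A, SmoothFn (fun x => lower (l x) A) U := fun A =>
    contMDiffOn_finsetSum fun B _ => (hlA B).mul contMDiffOn_const
  exact smoothFn_pi.2 fun A => (hlow A).div₀ hN fun x hx => sq_add_sq_ne_zero (hl0 x hx)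

theorem SmoothFn.raise {K : M → Fin 2 → ℝ} {U : Set M} (hK : SmoothFn K U) :
    SmoothFn (fun x => raise (K x)) U := by
  refine smoothFn_pi.2 fun A => ?_
  simp only [AlphaBeta.raise]
  exact contMDiffOn_finsetSum fun B _ => contMDiffOn_const.mul (smoothFn_pi.1 hK B)

theorem SmoothFn.contract {l m : M → Fin 2 → ℝ} {U : Set M} (hl : SmoothFn l U)
    (hm : SmoothFn m U) : SmoothFn (fun x => contract (l x) (m x)) U := by
  have hlA := smoothFn_pi.1 hl
  have hmA := smoothFn_pi.1 hm
  simp only [contract_eq]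
  exact ((hlA 0).mul (hmA 1)).sub ((hlA 1).mul (hmA 0))

/-! ### Spin frames -/

namespace Frame

variable (e : Frame M) (x : M)

theorem vec_zero_right (m : Fin 2 → ℝ) : e.vec x m 0 = 0 := by
  simp [vec]

theorem vec_smul_left (c : ℝ) (m n : Fin 2 → ℝ) : e.vec x (c • m) n = c • e.vec x m n := by
  simp only [vec, Pi.smul_apply, smul_eq_mul, mul_assoc, mul_smul, Finset.smul_sum]

theorem vec_smul_right (c : ℝ) (m n : Fin 2 → ℝ) : e.vec x m (c • n) = c • e.vec x m n := by
  simp only [vec, Pi.smul_apply, smul_eq_mul, mul_left_comm _ c, mul_smul, Finset.smul_sum]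

theorem vec_single (A A' : Fin 2) : e.vec x (Pi.single A 1) (Pi.single A' 1) = e A A' x := by
  fin_cases A <;> fin_cases A' <;> simp [vec, Fin.sum_univ_two]

end Frame

section SpinFrame

variable [IsManifold (𝓡 4) ∞ M] {g : NeutralMetric M} {e : Frame M} {U : Set M} {x : M}

theorem Frame.inner_vec_right (v : TangentSpace (𝓡 4) x) (m n : Fin 2 → ℝ) :
    g.inner x v (e.vec x m n) =
      contract n fun A' => contract m fun A => e.comp g x v A A' := by
  simp only [Frame.vec, Frame.comp, Fin.sum_univ_two, map_add, map_smul, smul_eq_mul, contract_eq]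
  simp [eps]
  ring

variable (g e x) in
/-- The components `v^{AA'}` as a linear map of `v`. -/
def Frame.compMap : TangentSpace (𝓡 4) x →ₗ[ℝ] Fin 2 → Fin 2 → ℝ where
  toFun v := e.comp g x v
  map_add' v w := by
    ext A A'
    simp only [Frame.comp, map_add, add_apply, mul_add, Finset.sum_add_distrib, Pi.add_apply]
  map_smul' c v := by
    ext A A'
    simp only [Frame.comp, map_smul, smul_apply, smul_eq_mul, mul_left_comm _ c, Finset.mul_sum,
      Pi.smul_apply, RingHom.id_apply]

theorem Frame.comp_add (v w : TangentSpace (𝓡 4) x) (A A' : Fin 2) :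
    e.comp g x (v + w) A A' = e.comp g x v A A' + e.comp g x w A A' :=
  congrFun₂ ((e.compMap g x).map_add v w) A A'

namespace IsSpinFrame

theorem smoothVF_vec (h : IsSpinFrame g e U) {m n : M → Fin 2 → ℝ} (hm : SmoothFn m U)
    (hn : SmoothFn n U) : SmoothVF (fun x => e.vec x (m x) (n x)) U :=
  ContMDiffOn.sum_section fun A _ => ContMDiffOn.sum_section fun A' _ =>
    ContMDiffOn.smul_section ((smoothFn_pi.1 hm A).mul (smoothFn_pi.1 hn A')) (h.smooth A A')

variable (h : IsSpinFrame g e U) (hx : x ∈ U)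

include h hx

theorem inner_vec (m n m' n' : Fin 2 → ℝ) :
    g.inner x (e.vec x m n) (e.vec x m' n') = contract m m' * contract n n' := by
  simp only [Frame.vec, Fin.sum_univ_two, map_add, map_smul, add_apply, smul_apply,
    h.inner_eq x hx, contract_eq, smul_eq_mul]
  simp [eps]
  ring

theorem comp_vec (m n : Fin 2 → ℝ) (A A' : Fin 2) :
    e.comp g x (e.vec x m n) A A' = m A * n A' := by
  simp only [Frame.comp, ← e.vec_single x, h.inner_vec hx, Fin.sum_univ_two, contract_eq]
  fin_cases A <;> fin_cases A' <;> simp [eps]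

theorem compMap_sum_smul (c : Fin 2 → Fin 2 → ℝ) :
    e.compMap g x (∑ A, ∑ A', c A A' • e A A' x) = c := by
  have hcomp : ∀ A A' B B', e.compMap g x (e A A' x) B B' =
      (Pi.single A 1 : Fin 2 → ℝ) B * (Pi.single A' 1 : Fin 2 → ℝ) B' := fun A A' B B' => by
    rw [← e.vec_single x]
    exact h.comp_vec hx _ _ B B'
  ext B B'
  fin_cases B <;> fin_cases B' <;> simp [hcomp]

theorem ext_comp {v w : TangentSpace (𝓡 4) x}
    (hvw : ∀ A A', e.comp g x v A A' = e.comp g x w A A') : v = w := by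
  have hrank : Module.finrank ℝ (TangentSpace (𝓡 4) x) =
      Module.finrank ℝ (Fin 2 → Fin 2 → ℝ) := by
    rw [show Module.finrank ℝ (TangentSpace (𝓡 4) x) = Module.finrank ℝ E4 from rfl]
    simp [Module.finrank_pi_fintype]
  have hsurj : Function.Surjective (e.compMap g x) := fun c => ⟨_, h.compMap_sum_smul hx c⟩
  exact (LinearMap.injective_iff_surjective_of_finrank_eq_finrank hrank).2 hsurj
    (funext₂ hvw)

theorem sum_comp_smul (v : TangentSpace (𝓡 4) x) :
    ∑ A, ∑ A', e.comp g x v A A' • e A A' x = v :=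
  h.ext_comp hx (congrFun₂ (h.compMap_sum_smul hx _))

theorem eq_vec_add_vec_dyadMate {l : Fin 2 → ℝ} (hl : l ≠ 0) (v : TangentSpace (𝓡 4) x) :
    v = e.vec x l (fun A' => contract (fun A => e.comp g x v A A') (dyadMate l)) +
      e.vec x (dyadMate l) (fun A' => contract l fun A => e.comp g x v A A') := by
  refine h.ext_comp hx fun A A' => ?_
  rw [Frame.comp_add, h.comp_vec hx, h.comp_vec hx, mul_comm (l A), mul_comm (dyadMate l A)]
  exact congrFun (dyad_expansion (contract_dyadMate hl) fun A => e.comp g x v A A') A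

theorem exists_eq_vec {l : Fin 2 → ℝ} (hl : l ≠ 0) {v : TangentSpace (𝓡 4) x}
    (hv : ∀ r, g.inner x v (e.vec x l r) = 0) : ∃ n, v = e.vec x l n := by
  have hcol : (fun A' => contract l fun A => e.comp g x v A A') = 0 :=
    eq_zero_of_forall_contract_eq_zero fun r => by rw [← Frame.inner_vec_right, hv]
  have hexp := h.eq_vec_add_vec_dyadMate hx hl v
  rw [hcol, Frame.vec_zero_right, add_zero] at hexp
  exact ⟨_, hexp⟩

theorem exists_eq_vec_add_vec {l p : Fin 2 → ℝ} (hl : l ≠ 0) (hp : p ≠ 0)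
    {v : TangentSpace (𝓡 4) x} (hv : g.inner x v (e.vec x l p) = 0) :
    ∃ m n, v = e.vec x m p + e.vec x l n := by
  rw [Frame.inner_vec_right] at hv
  have hexp := h.eq_vec_add_vec_dyadMate hx hl v
  rw [eq_smul_of_contract_eq_zero hp hv, Frame.vec_smul_right, ← Frame.vec_smul_left,
    add_comm] at hexp
  exact ⟨_, _, hexp⟩

end IsSpinFrame

end SpinFrame

/-! ### The connection on unprimed spinors -/

section SpinConnection

variable [IsManifold (𝓡 4) ∞ M]
  {g : NeutralMetric M} {e : Frame M} {U : Set M} {x : M} {X Y : VF M} {l m n : M → Fin 2 → ℝ}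

theorem leviCivita_vec (hX : DiffVF X x) (he : ∀ A A', DiffVF (e A A') x)
    (hm : ∀ A, DiffAt (fun y => m y A) x) (hn : ∀ A', DiffAt (fun y => n y A') x) :
    leviCivita g X (fun y => e.vec y (m y) (n y)) x =
      e.vec x (fun A => dirDeriv X (fun y => m y A) x) (n x) +
      e.vec x (m x) (fun A' => dirDeriv X (fun y => n y A') x) +
      ∑ A, ∑ A', (m x A * n x A') • leviCivita g X (e A A') x := by
  let c : Fin 2 → Fin 2 → M → ℝ := fun A A' y => m y A * n y A'
  have hc : ∀ A A', DiffAt (c A A') x := fun A A' => (hm A).mul (hn A')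
  have hce : ∀ A A', DiffVF (c A A' • e A A') x := fun A A' => DiffVF.smul (hc A A') (he A A')
  have hvec : (fun y => e.vec y (m y) (n y)) =
      (c 0 0 • e 0 0 + c 0 1 • e 0 1) + (c 1 0 • e 1 0 + c 1 1 • e 1 1) := by
    ext1 y
    simp only [Frame.vec, Fin.sum_univ_two, Pi.add_apply, Pi.smul_apply', c]
  rw [hvec, leviCivita_add_right g hX (DiffVF.add (hce 0 0) (hce 0 1))
      (DiffVF.add (hce 1 0) (hce 1 1)),
    leviCivita_add_right g hX (hce 0 0) (hce 0 1), leviCivita_add_right g hX (hce 1 0) (hce 1 1)]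
  simp only [leviCivita_smul_right g hX (hc _ _) (he _ _), c, dirDeriv_mul X (hm _) (hn _),
    Frame.vec, Fin.sum_univ_two]
  module

theorem IsSpinFrame.leviCivita_eq_sum_comp (h : IsSpinFrame g e U) (hU : IsOpen U) (hx : x ∈ U)
    (hX : DiffVF X x) (hY : DiffVF Y x) :
    leviCivita g X Y x = ∑ B, ∑ B', e.comp g x (X x) B B' • leviCivita g (e B B') Y x := by
  have hT := tensorialAt_leviCivita g hY
  have hframe : ∀ B B', hT.mkHom _ x (e B B' x) = leviCivita g (e B B') Y x := fun B B' =>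
    hT.mkHom_apply ((h.smooth B B').diffVF hU hx)
  rw [← hT.mkHom_apply hX]
  conv_lhs => rw [← h.sum_comp_smul hx (X x)]
  simp only [map_sum, map_smul, hframe]

variable (g e) in
/-- The matrix `λ^A λ^B g(∇_X e_{AA'}, e_{BB'})` with indices `A'`, `B'`, for a spinor `λ^A` at
`x`. -/
def Frame.connMatrix (X : VF M) (x : M) (l : Fin 2 → ℝ) (A' B' : Fin 2) : ℝ :=
  ∑ A, ∑ B, l A * l B * g.inner x (leviCivita g X (e A A') x) (e B B' x)

theorem IsSpinFrame.connMatrix_antisymm (h : IsSpinFrame g e U) (hU : IsOpen U) (hx : x ∈ U)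
    (hX : DiffVF X x) (l : Fin 2 → ℝ) (A' B' : Fin 2) :
    e.connMatrix g X x l A' B' = -e.connMatrix g X x l B' A' := by
  have hantisymm : ∀ A B, g.inner x (leviCivita g X (e A A') x) (e B B' x) =
      -g.inner x (leviCivita g X (e B B') x) (e A A' x) := fun A B =>
    inner_leviCivita_eq_neg g hX ((h.smooth A A').diffVF hU hx) ((h.smooth B B').diffVF hU hx)
      (Filter.eventually_of_mem (hU.mem_nhds hx) fun y hy => h.inner_eq y hy A A' B B')
  simp only [Frame.connMatrix, hantisymm, Fin.sum_univ_two]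
  ring

theorem IsSpinFrame.contract_spinCoeff (h : IsSpinFrame g e U) (hU : IsOpen U) (hx : x ∈ U)
    (hX : DiffVF X x) (l : Fin 2 → ℝ) :
    contract l (fun A => ∑ B, e.spinCoeff g X x A B * l B) = -e.connMatrix g X x l 0 1 := by
  have hswap := h.connMatrix_antisymm hU hx hX l 1 0
  have hhalf : contract l (fun A => ∑ B, e.spinCoeff g X x A B * l B) =
      (e.connMatrix g X x l 1 0 - e.connMatrix g X x l 0 1) / 2 := by
    simp only [contract_eq, Frame.spinCoeff, Frame.comp, Frame.connMatrix, Fin.sum_univ_two]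
    simp [eps]
    ring
  linarith

theorem inner_sum_smul_leviCivita (X : VF M) (l n r : Fin 2 → ℝ) :
    g.inner x (∑ A, ∑ A', (l A * n A') • leviCivita g X (e A A') x) (e.vec x l r) =
      ∑ A', ∑ B', n A' * r B' * e.connMatrix g X x l A' B' := by
  simp only [Frame.vec, Frame.connMatrix, Fin.sum_univ_two, map_add, map_smul, add_apply,
    smul_apply, smul_eq_mul]
  ring

theorem contract_spinDeriv (X : VF M) (l : M → Fin 2 → ℝ) (x : M) :
    contract (l x) (e.spinDeriv g X l x) =
      contract (l x) (fun A => dirDeriv X (fun y => l y A) x) +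
      contract (l x) (fun A => ∑ B, e.spinCoeff g X x A B * l x B) := by
  simp only [contract_eq, Frame.spinDeriv]
  ring

theorem IsSpinFrame.inner_leviCivita_vec_spinDeriv (h : IsSpinFrame g e U) (hU : IsOpen U)
    (hx : x ∈ U) (hX : DiffVF X x) (hl : SmoothFn l U) (hn : SmoothFn n U) (r : Fin 2 → ℝ) :
    g.inner x (leviCivita g X (fun y => e.vec y (l y) (n y)) x) (e.vec x (l x) r) =
      -(contract (l x) (e.spinDeriv g X l x) * contract (n x) r) := by
  rw [leviCivita_vec hX (fun A A' => (h.smooth A A').diffVF hU hx)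
      (fun A => (smoothFn_pi.1 hl A).diffAt hU hx) (fun A' => (smoothFn_pi.1 hn A').diffAt hU hx),
    map_add, map_add, add_apply, add_apply, h.inner_vec hx, h.inner_vec hx,
    inner_sum_smul_leviCivita, sum_mul_mul_of_antisymm _ _ (h.connMatrix_antisymm hU hx hX (l x)),
    contract_self, contract_swap (l x), contract_spinDeriv, h.contract_spinCoeff hU hx hX]
  ring

/-! ### The covector `S̃` -/

variable (g e) in
/-- The covector `S̃_b = λ_A ∇_b λ^A` as a linear form on the tangent space. -/
def Frame.tildeSForm (l : M → Fin 2 → ℝ) (x : M) : TangentSpace (𝓡 4) x →ₗ[ℝ] ℝ :=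
  ∑ B, ∑ B', e.tildeS g l x B B' • LinearMap.proj B' ∘ₗ LinearMap.proj B ∘ₗ e.compMap g x

theorem Frame.tildeSForm_apply (l : M → Fin 2 → ℝ) (v : TangentSpace (𝓡 4) x) :
    e.tildeSForm g l x v = ∑ B, ∑ B', e.tildeS g l x B B' * e.comp g x v B B' := by
  simp [Frame.tildeSForm, Frame.compMap]

namespace IsSpinFrame

theorem tildeSForm_vec (h : IsSpinFrame g e U) (hx : x ∈ U) (l : M → Fin 2 → ℝ)
    (m n : Fin 2 → ℝ) :
    e.tildeSForm g l x (e.vec x m n) = ∑ B, ∑ B', e.tildeS g l x B B' * (m B * n B') := by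
  simp only [Frame.tildeSForm_apply, h.comp_vec hx]

theorem inner_leviCivita_vec (h : IsSpinFrame g e U) (hU : IsOpen U) (hx : x ∈ U)
    (hX : DiffVF X x) (hl : SmoothFn l U) (hn : SmoothFn n U) (r : Fin 2 → ℝ) :
    g.inner x (leviCivita g X (fun y => e.vec y (l y) (n y)) x) (e.vec x (l x) r) =
      -(e.tildeSForm g l x (X x) * contract (n x) r) := by
  have hframe : ∀ B B', g.inner x (leviCivita g (e B B') (fun y => e.vec y (l y) (n y)) x)
      (e.vec x (l x) r) = -(e.tildeS g l x B B' * contract (n x) r) := fun B B' =>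
    h.inner_leviCivita_vec_spinDeriv hU hx ((h.smooth B B').diffVF hU hx) hl hn r
  rw [h.leviCivita_eq_sum_comp hU hx hX ((h.smoothVF_vec hl hn).diffVF hU hx),
    Frame.tildeSForm_apply]
  simp only [map_sum, sum_apply, map_smul, smul_apply, hframe, smul_eq_mul, Finset.sum_mul,
    ← Finset.sum_neg_distrib]
  exact Finset.sum_congr rfl fun B _ => Finset.sum_congr rfl fun B' _ => by ring

theorem smoothFn_tildeS (h : IsSpinFrame g e U) (hU : IsOpen U) (hl : SmoothFn l U)
    (B B' : Fin 2) : SmoothFn (fun x => e.tildeS g l x B B') U := by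
  have hconst : ∀ c : Fin 2 → ℝ, SmoothFn (fun _ : M => c) U := fun c => smoothFn_const c U
  have hsmooth := (h.smooth B B').inner_leviCivita g (h.smoothVF_vec hl (hconst (Pi.single 1 1)))
    (h.smoothVF_vec hl (hconst (Pi.single 0 1))) hU
  refine hsmooth.congr fun x hx => ?_
  rw [h.inner_leviCivita_vec_spinDeriv hU hx ((h.smooth B B').diffVF hU hx) hl (hconst _)]
  simp [contract_eq, Frame.tildeS]

end IsSpinFrame

theorem spinDeriv_smul (X : VF M) {f : M → ℝ} (hf : DiffAt f x)
    (hl : ∀ A, DiffAt (fun y => l y A) x) :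
    e.spinDeriv g X (fun y => f y • l y) x = dirDeriv X f x • l x + f x • e.spinDeriv g X l x := by
  ext A
  simp only [Frame.spinDeriv, Pi.smul_apply, Pi.add_apply, smul_eq_mul, dirDeriv_mul X hf (hl A),
    Fin.sum_univ_two]
  ring

theorem tildeS_smul {f : M → ℝ} (hf : DiffAt f x) (hl : ∀ A, DiffAt (fun y => l y A) x)
    (B B' : Fin 2) :
    e.tildeS g (fun y => f y • l y) x B B' = f x ^ 2 * e.tildeS g l x B B' := by
  rw [Frame.tildeS, spinDeriv_smul _ hf hl, contract_smul_left, contract_add_right,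
    contract_smul_right, contract_smul_right, contract_self, Frame.tildeS]
  ring

end SpinConnection

/-! ### Integrable and parallel distributions -/

section Distributions

variable [IsManifold (𝓡 4) ∞ M]
  {g : NeutralMetric M} {D : Distribution M} {X Y : VF M} {U V : Set M} {x : M}

theorem IsSection.mono (h : IsSection D X U) (hVU : V ⊆ U) : IsSection D X V :=
  ⟨h.smooth.mono hVU, fun x hx => h.mem x (hVU hx)⟩

theorem IsSection.eventually_mem (h : IsSection D X U) (hU : IsOpen U) (hx : x ∈ U) :
    ∀ᶠ y in nhds x, X y ∈ D y :=
  Filter.eventually_of_mem (hU.mem_nhds hx) h.mem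

theorem IsIntegrableOn.mono (h : IsIntegrableOn D U) (hVU : V ⊆ U) : IsIntegrableOn D V :=
  fun V' hV' hV'V => h V' hV' (hV'V.trans hVU)

theorem IsParallelOn.mono (h : IsParallelOn g D U) (hVU : V ⊆ U) : IsParallelOn g D V :=
  fun V' hV' hV'V => h V' hV' (hV'V.trans hVU)

theorem IsAutoParallelOn.isIntegrableOn (h : IsAutoParallelOn g D U) : IsIntegrableOn D U := by
  intro V hV hVU X Y hX hY x hx
  rw [mlieBracket_eq_leviCivita_sub g (hX.smooth.diffVF hV hx) (hY.smooth.diffVF hV hx)]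
  exact sub_mem (h V hV hVU X Y hX hY x hx) (h V hV hVU Y X hY hX x hx)

theorem isIntegrableOn_biUnion {ι : Type*} {s : Set ι} {u : ι → Set M}
    (hu : ∀ i ∈ s, IsOpen (u i)) :
    IsIntegrableOn D (⋃ i ∈ s, u i) ↔ ∀ i ∈ s, IsIntegrableOn D (u i) := by
  refine ⟨fun h i hi => h.mono (Set.subset_biUnion_of_mem hi), fun h V hV hVu X Y hX hY x hx => ?_⟩
  obtain ⟨i, hi, hxi⟩ := Set.mem_iUnion₂.1 (hVu hx)
  exact h i hi (V ∩ u i) (hV.inter (hu i hi)) Set.inter_subset_right X Y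
    (hX.mono Set.inter_subset_left) (hY.mono Set.inter_subset_left) x ⟨hx, hxi⟩

theorem isAutoParallelOn_of_locally
    (h : ∀ x ∈ U, ∃ V, IsOpen V ∧ x ∈ V ∧ IsAutoParallelOn g D (V ∩ U)) :
    IsAutoParallelOn g D U := by
  intro V' hV' hV'U X Y hX hY x hx
  obtain ⟨V, hV, hxV, hVU⟩ := h x (hV'U hx)
  exact hVU (V ∩ V') (hV.inter hV') (Set.inter_subset_inter_right V hV'U) X Y
    (hX.mono Set.inter_subset_right) (hY.mono Set.inter_subset_right) x ⟨hxV, hx⟩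

/-! ### The distributions `Z`, `W` and `𝓗` -/

namespace ScaledReps

variable {Z W : Distribution M} (R : ScaledReps g Z W)

/-- The scaled representatives `R` restricted to a smaller domain. -/
def restrict (hU : IsOpen U) : ScaledReps g Z W where
  dom := R.dom ∩ U
  isOpen_dom := R.isOpen_dom.inter hU
  e := R.e
  isSpinFrame := ⟨fun A A' => (R.isSpinFrame.smooth A A').mono Set.inter_subset_left,
    fun x hx => R.isSpinFrame.inner_eq x hx.1⟩
  p := R.p
  isRep_p := ⟨R.isRep_p.smooth.mono Set.inter_subset_left, fun x hx => R.isRep_p.ne_zero x hx.1,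
    fun x hx => R.isRep_p.mem_iff x hx.1⟩
  l := R.l
  isRep_l := ⟨R.isRep_l.smooth.mono Set.inter_subset_left, fun x hx => R.isRep_l.ne_zero x hx.1,
    fun x hx => R.isRep_l.mem_iff x hx.1⟩

section Pointwise

variable (hx : x ∈ R.dom)

include hx

theorem vec_mem_Z (m : Fin 2 → ℝ) : R.e.vec x m (R.p x) ∈ Z x :=
  (R.isRep_p.mem_iff x hx _).2 ⟨m, rfl⟩

theorem vec_mem_W (n : Fin 2 → ℝ) : R.e.vec x (R.l x) n ∈ W x :=
  (R.isRep_l.mem_iff x hx _).2 ⟨n, rfl⟩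

theorem inner_eq_zero_of_mem_Z {v w : TangentSpace (𝓡 4) x} (hv : v ∈ Z x) (hw : w ∈ Z x) :
    g.inner x v w = 0 := by
  obtain ⟨m, rfl⟩ := (R.isRep_p.mem_iff x hx _).1 hv
  obtain ⟨m', rfl⟩ := (R.isRep_p.mem_iff x hx _).1 hw
  rw [R.isSpinFrame.inner_vec hx, contract_self, mul_zero]

theorem inner_eq_zero_of_mem_W {v w : TangentSpace (𝓡 4) x} (hv : v ∈ W x) (hw : w ∈ W x) :
    g.inner x v w = 0 := by
  obtain ⟨n, rfl⟩ := (R.isRep_l.mem_iff x hx _).1 hv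
  obtain ⟨n', rfl⟩ := (R.isRep_l.mem_iff x hx _).1 hw
  rw [R.isSpinFrame.inner_vec hx, contract_self, zero_mul]

theorem mem_W_iff_inner_eq_zero {v : TangentSpace (𝓡 4) x} :
    v ∈ W x ↔ ∀ r, g.inner x v (R.e.vec x (R.l x) r) = 0 :=
  ⟨fun hv r => R.inner_eq_zero_of_mem_W hx hv (R.vec_mem_W hx r), fun h =>
    (R.isRep_l.mem_iff x hx _).2 (R.isSpinFrame.exists_eq_vec hx (R.isRep_l.ne_zero x hx) h)⟩

theorem inf_eq_span : Z x ⊓ W x = ℝ ∙ R.e.vec x (R.l x) (R.p x) := by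
  refine le_antisymm ?_ ((Submodule.span_singleton_le_iff_mem _ _).2
    ⟨R.vec_mem_Z hx _, R.vec_mem_W hx _⟩)
  rintro w ⟨hwZ, hwW⟩
  obtain ⟨m, rfl⟩ := (R.isRep_p.mem_iff x hx _).1 hwZ
  have hcontract : contract m (R.l x) = 0 := by
    simpa [R.isSpinFrame.inner_vec hx, contract_dyadMate (R.isRep_p.ne_zero x hx)] using
      (R.mem_W_iff_inner_eq_zero hx).1 hwW (dyadMate (R.p x))
  rw [contract_swap, neg_eq_zero] at hcontract
  rw [eq_smul_of_contract_eq_zero (R.isRep_l.ne_zero x hx) hcontract, Frame.vec_smul_left]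
  exact Submodule.smul_mem _ _ (Submodule.mem_span_singleton_self _)

theorem mem_distH_iff {v : TangentSpace (𝓡 4) x} :
    v ∈ distH g Z W x ↔ g.inner x v (R.e.vec x (R.l x) (R.p x)) = 0 := by
  rw [distH, perp, R.inf_eq_span hx, LinearMap.BilinForm.orthogonal_span_singleton_eq_toLin_ker,
    LinearMap.mem_ker, g.symm]
  rfl

theorem distH_eq_sup : distH g Z W x = Z x ⊔ W x := by
  refine le_antisymm (fun v hv => ?_) (sup_le (fun v hv => ?_) fun v hv => ?_)
  · obtain ⟨m, n, rfl⟩ := R.isSpinFrame.exists_eq_vec_add_vec hx (R.isRep_l.ne_zero x hx)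
      (R.isRep_p.ne_zero x hx) ((R.mem_distH_iff hx).1 hv)
    exact Submodule.add_mem_sup (R.vec_mem_Z hx m) (R.vec_mem_W hx n)
  · exact (R.mem_distH_iff hx).2 (R.inner_eq_zero_of_mem_Z hx hv (R.vec_mem_Z hx _))
  · exact (R.mem_distH_iff hx).2 (R.inner_eq_zero_of_mem_W hx hv (R.vec_mem_W hx _))

theorem Z_le_distH : Z x ≤ distH g Z W x := by
  rw [R.distH_eq_sup hx]
  exact le_sup_left

theorem W_le_distH : W x ≤ distH g Z W x := by
  rw [R.distH_eq_sup hx]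
  exact le_sup_right

end Pointwise

theorem isSection_vec_Z {m : M → Fin 2 → ℝ} (hm : SmoothFn m R.dom) :
    IsSection Z (fun y => R.e.vec y (m y) (R.p y)) R.dom :=
  ⟨R.isSpinFrame.smoothVF_vec hm R.isRep_p.smooth,
    fun _ hx => R.vec_mem_Z hx _⟩

theorem isSection_vec_W {n : M → Fin 2 → ℝ} (hn : SmoothFn n R.dom) :
    IsSection W (fun y => R.e.vec y (R.l y) (n y)) R.dom :=
  ⟨R.isSpinFrame.smoothVF_vec R.isRep_l.smooth hn,
    fun _ hx => R.vec_mem_W hx _⟩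

/-! ### Integrability and the kernel of `S̃` -/

/-- The vectors annihilated by the covector `S̃_b = λ_A ∇_b λ^A`. -/
def kerTildeS : Distribution M := fun x => LinearMap.ker (R.e.tildeSForm g R.l x)

theorem inner_leviCivita_of_mem_W (hx : x ∈ R.dom) (hX : DiffVF X x) (hY : DiffVF Y x)
    (hYW : ∀ᶠ y in nhds x, Y y ∈ W y) {n : Fin 2 → ℝ} (hn : Y x = R.e.vec x (R.l x) n)
    (r : Fin 2 → ℝ) :
    g.inner x (leviCivita g X Y x) (R.e.vec x (R.l x) r) =
      -(R.e.tildeSForm g R.l x (X x) * contract n r) := by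
  have hr := smoothFn_const r R.dom
  have horth : ∀ᶠ y in nhds x, g.inner y (Y y) (R.e.vec y (R.l y) r) = 0 := by
    filter_upwards [hYW, R.isOpen_dom.mem_nhds hx] with y hyW hyR
    exact R.inner_eq_zero_of_mem_W hyR hyW (R.vec_mem_W hyR r)
  rw [inner_leviCivita_eq_neg g hX hY ((R.isSection_vec_W hr).smooth.diffVF R.isOpen_dom hx) horth,
    hn, R.isSpinFrame.inner_leviCivita_vec R.isOpen_dom hx hX R.isRep_l.smooth hr, contract_swap]
  ring

theorem leviCivita_mem_W (hx : x ∈ R.dom) (hX : DiffVF X x) (hXS : X x ∈ R.kerTildeS x)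
    (hY : DiffVF Y x) (hYW : ∀ᶠ y in nhds x, Y y ∈ W y) : leviCivita g X Y x ∈ W x := by
  obtain ⟨n, hn⟩ := (R.isRep_l.mem_iff x hx _).1 hYW.self_of_nhds
  refine (R.mem_W_iff_inner_eq_zero hx).2 fun r => ?_
  rw [R.inner_leviCivita_of_mem_W hx hX hY hYW hn, LinearMap.mem_ker.1 hXS, zero_mul, neg_zero]

theorem isAutoParallelOn_W (h : ∀ x ∈ R.dom, W x ≤ R.kerTildeS x) :
    IsAutoParallelOn g W R.dom := fun _ hV hVR _ _ hX hY x hx =>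
  R.leviCivita_mem_W (hVR hx) (hX.smooth.diffVF hV hx) (h x (hVR hx) (hX.mem x hx))
    (hY.smooth.diffVF hV hx) (hY.eventually_mem hV hx)

theorem W_le_kerTildeS (h : IsIntegrableOn W R.dom) (hx : x ∈ R.dom) :
    W x ≤ R.kerTildeS x := by
  intro v hv
  obtain ⟨n, rfl⟩ := (R.isRep_l.mem_iff x hx _).1 hv
  rcases eq_or_ne n 0 with rfl | hn
  · rw [Frame.vec_zero_right]
    exact zero_mem _
  have hX := R.isSection_vec_W (smoothFn_const n R.dom)
  have hY := R.isSection_vec_W (smoothFn_const (dyadMate n) R.dom)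
  have hX' := hX.smooth.diffVF R.isOpen_dom hx
  have hY' := hY.smooth.diffVF R.isOpen_dom hx
  have hbracket := (R.mem_W_iff_inner_eq_zero hx).1
    (h R.dom R.isOpen_dom subset_rfl _ _ hX hY x hx) n
  rw [mlieBracket_eq_leviCivita_sub g hX' hY', map_sub, sub_apply,
    R.inner_leviCivita_of_mem_W hx hX' hY' (hY.eventually_mem R.isOpen_dom hx) rfl,
    R.inner_leviCivita_of_mem_W hx hY' hX' (hX.eventually_mem R.isOpen_dom hx) rfl,
    contract_self, contract_swap n, contract_dyadMate hn] at hbracket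
  exact LinearMap.mem_ker.2 (by linarith)

theorem isAutoParallelOn_distH (hZ : IsParallelOn g Z R.dom)
    (h : ∀ x ∈ R.dom, distH g Z W x ≤ R.kerTildeS x) :
    IsAutoParallelOn g (distH g Z W) R.dom := by
  intro V hV hVR X Y hX hY x hx
  have hxR := hVR hx
  have hX' := hX.smooth.diffVF hV hx
  have hTW := R.isSection_vec_W R.isRep_p.smooth
  have hTZ := (R.isSection_vec_Z R.isRep_l.smooth).mono hVR
  have horth : ∀ᶠ y in nhds x, g.inner y (Y y) (R.e.vec y (R.l y) (R.p y)) = 0 :=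
    Filter.eventually_of_mem (hV.mem_nhds hx) fun y hy =>
      (R.mem_distH_iff (hVR hy)).1 (hY.mem y hy)
  obtain ⟨a, ha, b, hb, hab⟩ := Submodule.mem_sup.1 (R.distH_eq_sup hxR ▸ hY.mem x hx)
  have hinner_a := R.inner_eq_zero_of_mem_Z hxR (hZ V hV hVR X _ hX.smooth hTZ x hx) ha
  have hinner_b := R.inner_eq_zero_of_mem_W hxR (R.leviCivita_mem_W hxR hX'
    (h x hxR (hX.mem x hx)) (hTW.smooth.diffVF R.isOpen_dom hxR)
    (hTW.eventually_mem R.isOpen_dom hxR)) hb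
  rw [R.mem_distH_iff hxR, inner_leviCivita_eq_neg g hX' (hY.smooth.diffVF hV hx)
    (hTW.smooth.diffVF R.isOpen_dom hxR) horth, ← hab, map_add, hinner_a, hinner_b, add_zero,
    neg_zero]

theorem Z_le_kerTildeS (hZ : IsParallelOn g Z R.dom) (h : IsIntegrableOn (distH g Z W) R.dom)
    (hx : x ∈ R.dom) : Z x ≤ R.kerTildeS x := by
  intro v hv
  obtain ⟨m, rfl⟩ := (R.isRep_p.mem_iff x hx _).1 hv
  have hX := R.isSection_vec_Z (smoothFn_const m R.dom)
  have hY := R.isSection_vec_W (smoothFn_const (dyadMate (R.p x)) R.dom)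
  have hX' := hX.smooth.diffVF R.isOpen_dom hx
  have hY' := hY.smooth.diffVF R.isOpen_dom hx
  have hbracket := (R.mem_distH_iff hx).1 (h R.dom R.isOpen_dom subset_rfl _ _
    ⟨hX.smooth, fun y hy => R.Z_le_distH hy (hX.mem y hy)⟩
    ⟨hY.smooth, fun y hy => R.W_le_distH hy (hY.mem y hy)⟩ x hx)
  rw [mlieBracket_eq_leviCivita_sub g hX' hY', map_sub, sub_apply,
    R.inner_eq_zero_of_mem_Z hx (hZ R.dom R.isOpen_dom subset_rfl _ _ hY.smooth hX x hx)
      (R.vec_mem_Z hx _),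
    R.inner_leviCivita_of_mem_W hx hX' hY' (hY.eventually_mem R.isOpen_dom hx) rfl, contract_swap,
    contract_dyadMate (R.isRep_p.ne_zero x hx)] at hbracket
  exact LinearMap.mem_ker.2 (by linarith)

theorem isIntegrableOn_W_and_distH_iff (hZ : IsParallelOn g Z R.dom) :
    IsIntegrableOn W R.dom ∧ IsIntegrableOn (distH g Z W) R.dom ↔
      ∀ x ∈ R.dom, distH g Z W x ≤ R.kerTildeS x := by
  refine ⟨fun ⟨hW, hH⟩ x hx => ?_, fun h => ⟨?_, ?_⟩⟩
  · rw [R.distH_eq_sup hx]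
    exact sup_le (R.Z_le_kerTildeS hZ hH hx) (R.W_le_kerTildeS hW hx)
  · exact (R.isAutoParallelOn_W fun x hx => (R.W_le_distH hx).trans (h x hx)).isIntegrableOn
  · exact (R.isAutoParallelOn_distH hZ h).isIntegrableOn

/-! ### The spinor `κ` -/

section Pointwise

variable (hx : x ∈ R.dom)

include hx

theorem tildeSForm_vec_of_eq {q : Fin 2 → ℝ}
    (hq : ∀ B B', R.e.tildeS g R.l x B B' = lower (R.l x) B * lower q B') (m n : Fin 2 → ℝ) :
    R.e.tildeSForm g R.l x (R.e.vec x m n) = contract (R.l x) m * contract q n := by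
  rw [R.isSpinFrame.tildeSForm_vec hx, contract, contract, Finset.sum_mul_sum]
  simp only [hq, mul_mul_mul_comm]

theorem distH_le_kerTildeS_iff {q : Fin 2 → ℝ}
    (hq : ∀ B B', R.e.tildeS g R.l x B B' = lower (R.l x) B * lower q B') :
    distH g Z W x ≤ R.kerTildeS x ↔ contract (R.p x) q = 0 := by
  have hS := R.tildeSForm_vec_of_eq hx hq
  rw [R.distH_eq_sup hx, contract_swap, neg_eq_zero]
  refine ⟨fun h => ?_, fun h => sup_le (fun v hv => ?_) fun v hv => ?_⟩
  · have hker := LinearMap.mem_ker.1 <|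
      (le_sup_left.trans h) (R.vec_mem_Z hx (dyadMate (R.l x)))
    rwa [hS, contract_dyadMate (R.isRep_l.ne_zero x hx), one_mul] at hker
  · obtain ⟨m, rfl⟩ := (R.isRep_p.mem_iff x hx _).1 hv
    exact LinearMap.mem_ker.2 (by rw [hS, h, mul_zero])
  · obtain ⟨n, rfl⟩ := (R.isRep_l.mem_iff x hx _).1 hv
    exact LinearMap.mem_ker.2 (by rw [hS, contract_self, zero_mul])

end Pointwise

/-- The spinor `κ_{B'}` with `S̃_b = λ_B κ_{B'}`, when such a spinor exists, with its index
raised. It is the contraction of `S̃_b` with a spinor `μ^B` satisfying `λ_B μ^B = 1`. -/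
def kappa (x : M) : Fin 2 → ℝ :=
  raise fun B' => ∑ B, dyadMate (R.l x) B * R.e.tildeS g R.l x B B'

theorem smoothFn_kappa : SmoothFn R.kappa R.dom := by
  have hmate := smoothFn_pi.1 (R.isRep_l.smooth.dyadMate R.isRep_l.ne_zero)
  have hcontract : ∀ B', SmoothFn
      (fun x => ∑ B, dyadMate (R.l x) B * R.e.tildeS g R.l x B B') R.dom := fun B' =>
    contMDiffOn_finsetSum fun B _ =>
      (hmate B).mul (R.isSpinFrame.smoothFn_tildeS R.isOpen_dom R.isRep_l.smooth B B')
  exact (smoothFn_pi.2 hcontract).raise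

theorem tildeS_eq_lower_mul_lower_kappa (hx : x ∈ R.dom) (h : W x ≤ R.kerTildeS x)
    (B B' : Fin 2) :
    R.e.tildeS g R.l x B B' = lower (R.l x) B * lower (R.kappa x) B' := by
  have hW : ∑ B, R.l x B * R.e.tildeS g R.l x B B' = 0 := by
    have hker := LinearMap.mem_ker.1 (h (R.vec_mem_W hx (Pi.single B' 1)))
    rw [R.isSpinFrame.tildeSForm_vec hx] at hker
    simpa [Pi.single_apply, mul_comm] using hker
  rw [kappa, lower_raise]
  exact eq_lower_mul_of_sum_eq_zero (R.isRep_l.ne_zero x hx) hW B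

theorem isKappa_kappa (h : IsIntegrableOn W R.dom) : R.IsKappa R.kappa :=
  ⟨R.smoothFn_kappa, fun _ hx => R.tildeS_eq_lower_mul_lower_kappa hx (R.W_le_kerTildeS h hx)⟩

theorem distH_le_kerTildeS_iff_exists (hx : x ∈ R.dom) :
    distH g Z W x ≤ R.kerTildeS x ↔
      ∃ c, ∀ B B', R.e.tildeS g R.l x B B' = c * (lower (R.l x) B * lower (R.p x) B') := by
  constructor
  · intro h
    have hk := R.tildeS_eq_lower_mul_lower_kappa hx ((R.W_le_distH hx).trans h)
    obtain ⟨c, hc⟩ : ∃ c : ℝ, R.kappa x = c • R.p x :=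
      ⟨_, eq_smul_of_contract_eq_zero (R.isRep_p.ne_zero x hx)
        ((R.distH_le_kerTildeS_iff hx hk).1 h)⟩
    exact ⟨c, fun B B' => by rw [hk, hc, lower_smul, mul_left_comm]⟩
  · rintro ⟨c, hc⟩
    refine (R.distH_le_kerTildeS_iff hx (q := c • R.p x) fun B B' => ?_).2 ?_
    · rw [hc, lower_smul, mul_left_comm]
    · rw [contract_smul_right, contract_self, mul_zero]

theorem isIntegrableOn_W_and_distH_iff_exists (hZ : IsParallelOn g Z R.dom) :
    IsIntegrableOn W R.dom ∧ IsIntegrableOn (distH g Z W) R.dom ↔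
      ∃ f : M → ℝ, ∀ x ∈ R.dom, ∀ B B', R.e.tildeS g R.l x B B' =
        f x * (lower (R.l x) B * lower (R.p x) B') := by
  rw [R.isIntegrableOn_W_and_distH_iff hZ]
  refine ⟨fun h => ?_, fun ⟨f, hf⟩ x hx =>
    (R.distH_le_kerTildeS_iff_exists hx).2 ⟨f x, hf x hx⟩⟩
  choose! f hf using fun x hx => (R.distH_le_kerTildeS_iff_exists hx).1 (h x hx)
  exact ⟨f, hf⟩

variable {R} in
theorem IsKappa.isIntegrableOn_distH_iff {k : M → Fin 2 → ℝ} (hk : R.IsKappa k)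
    (hZ : IsParallelOn g Z R.dom) (hW : IsIntegrableOn W R.dom) :
    IsIntegrableOn (distH g Z W) R.dom ↔ ∀ x ∈ R.dom, contract (R.p x) (k x) = 0 := by
  rw [← and_iff_right hW (b := IsIntegrableOn (distH g Z W) R.dom),
    R.isIntegrableOn_W_and_distH_iff hZ]
  exact forall₂_congr fun x hx => R.distH_le_kerTildeS_iff hx (hk.eq x hx)

/-! ### Rescaling the representatives -/

theorem forall_contract_eq_zero_iff_exists_smul {k : M → Fin 2 → ℝ} (hk : SmoothFn k R.dom) :
    (∀ x ∈ R.dom, contract (R.p x) (k x) = 0) ↔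
      ∃ f : M → ℝ, SmoothFn f R.dom ∧ ∀ x ∈ R.dom, k x = f x • R.p x := by
  refine ⟨fun h => ⟨fun x => contract (k x) (dyadMate (R.p x)),
    hk.contract (R.isRep_p.smooth.dyadMate R.isRep_p.ne_zero), fun x hx =>
      eq_smul_of_contract_eq_zero (R.isRep_p.ne_zero x hx) (h x hx)⟩, ?_⟩
  rintro ⟨f, -, hf⟩ x hx
  rw [hf x hx, contract_smul_right, contract_self, mul_zero]

theorem isRepAlpha_of_eq_smul {k : M → Fin 2 → ℝ} (hk : SmoothFn k R.dom)
    (hk0 : ∀ x ∈ R.dom, k x ≠ 0) {f : M → ℝ} (hf : ∀ x ∈ R.dom, k x = f x • R.p x) :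
    IsRepAlpha R.e R.dom Z k := by
  refine ⟨hk, hk0, fun x hx v => ?_⟩
  have hfx : f x ≠ 0 := left_ne_zero_of_smul (hf x hx ▸ hk0 x hx)
  rw [R.isRep_p.mem_iff x hx, hf x hx]
  constructor
  · rintro ⟨m, rfl⟩
    exact ⟨(f x)⁻¹ • m, by rw [Frame.vec_smul_left, Frame.vec_smul_right, inv_smul_smul₀ hfx]⟩
  · rintro ⟨m, rfl⟩
    exact ⟨f x • m, by rw [Frame.vec_smul_left, Frame.vec_smul_right]⟩

theorem isRepBeta_smul {f : M → ℝ} (hf : SmoothFn f R.dom) (hf0 : ∀ x ∈ R.dom, f x ≠ 0) :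
    IsRepBeta R.e R.dom W fun x => f x • R.l x := by
  refine ⟨ContMDiffOn.smul hf R.isRep_l.smooth,
    fun x hx => smul_ne_zero (hf0 x hx) (R.isRep_l.ne_zero x hx), fun x hx v => ?_⟩
  rw [R.isRep_l.mem_iff x hx]
  constructor
  · rintro ⟨n, rfl⟩
    exact ⟨(f x)⁻¹ • n, by
      rw [Frame.vec_smul_left, Frame.vec_smul_right, smul_inv_smul₀ (hf0 x hx)]⟩
  · rintro ⟨n, rfl⟩
    exact ⟨f x • n, by rw [Frame.vec_smul_left, Frame.vec_smul_right]⟩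

theorem contract_eq_zero_of_isRepAlpha {k : M → Fin 2 → ℝ} (h : IsRepAlpha R.e R.dom Z k)
    (hx : x ∈ R.dom) : contract (R.p x) (k x) = 0 := by
  have hmem := (h.mem_iff x hx _).2 ⟨dyadMate (R.l x), rfl⟩
  have hinner := R.inner_eq_zero_of_mem_Z hx (R.vec_mem_Z hx (R.l x)) hmem
  rwa [R.isSpinFrame.inner_vec hx, contract_dyadMate (R.isRep_l.ne_zero x hx), one_mul] at hinner

theorem forall_contract_eq_zero_iff_isRepAlpha {k : M → Fin 2 → ℝ} (hk : SmoothFn k R.dom)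
    (hk0 : ∀ x ∈ R.dom, k x ≠ 0) :
    (∀ x ∈ R.dom, contract (R.p x) (k x) = 0) ↔ IsRepAlpha R.e R.dom Z k := by
  refine ⟨fun h => ?_, fun h x hx => R.contract_eq_zero_of_isRepAlpha h hx⟩
  obtain ⟨f, -, hf⟩ := (R.forall_contract_eq_zero_iff_exists_smul hk).1 h
  exact R.isRepAlpha_of_eq_smul hk hk0 hf

variable {R}

theorem IsKappa.ne_zero {k : M → Fin 2 → ℝ} (hk : R.IsKappa k) (hx : x ∈ R.dom)
    (hS : R.e.tildeS g R.l x ≠ 0) : k x ≠ 0 := by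
  contrapose! hS
  ext B B'
  simp [hk.eq x hx, hS, lower]

theorem IsKappa.tildeS_inv_smul {k : M → Fin 2 → ℝ} (hk : R.IsKappa k) {f : M → ℝ}
    (hf : SmoothFn f R.dom) (hkf : ∀ x ∈ R.dom, k x = f x • R.p x) (hx : x ∈ R.dom)
    (hfx : f x ≠ 0) (B B' : Fin 2) :
    R.e.tildeS g (fun y => (f y)⁻¹ • R.l y) x B B' =
      lower ((f x)⁻¹ • R.l x) B * lower (R.p x) B' := by
  have hinv : DiffAt (fun y => (f y)⁻¹) x :=
    ((hf.contMDiffAt (R.isOpen_dom.mem_nhds hx)).inv₀ hfx).mdifferentiableAt (by simp)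
  have hl : ∀ A, DiffAt (fun y => R.l y A) x := fun A =>
    (smoothFn_pi.1 R.isRep_l.smooth A).diffAt R.isOpen_dom hx
  rw [tildeS_smul hinv hl, hk.eq x hx, hkf x hx, lower_smul, lower_smul]
  field_simp

variable (R)

theorem exists_isRepAlpha_tildeS_eq (hZ : IsParallelOn g Z R.dom) (hW : IsIntegrableOn W R.dom)
    (hH : IsIntegrableOn (distH g Z W) R.dom) (hS : ∀ x ∈ R.dom, R.e.tildeS g R.l x ≠ 0) :
    ∃ p : M → Fin 2 → ℝ, IsRepAlpha R.e R.dom Z p ∧ ∀ x ∈ R.dom, ∀ B B',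
      R.e.tildeS g R.l x B B' = lower (R.l x) B * lower (p x) B' := by
  have hk := R.isKappa_kappa hW
  have hcontract := (hk.isIntegrableOn_distH_iff hZ hW).1 hH
  have hk0 : ∀ x ∈ R.dom, R.kappa x ≠ 0 := fun x hx => hk.ne_zero hx (hS x hx)
  exact ⟨R.kappa, (R.forall_contract_eq_zero_iff_isRepAlpha hk.smooth hk0).1 hcontract, hk.eq⟩

theorem exists_isRepBeta_tildeS_eq (hZ : IsParallelOn g Z R.dom) (hW : IsIntegrableOn W R.dom)
    (hH : IsIntegrableOn (distH g Z W) R.dom) (hS : ∀ x ∈ R.dom, R.e.tildeS g R.l x ≠ 0) :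
    ∃ l : M → Fin 2 → ℝ, IsRepBeta R.e R.dom W l ∧ ∀ x ∈ R.dom, ∀ B B',
      R.e.tildeS g l x B B' = lower (l x) B * lower (R.p x) B' := by
  have hk := R.isKappa_kappa hW
  obtain ⟨f, hf, hkf⟩ := (R.forall_contract_eq_zero_iff_exists_smul hk.smooth).1
    ((hk.isIntegrableOn_distH_iff hZ hW).1 hH)
  have hf0 : ∀ x ∈ R.dom, f x ≠ 0 := fun x hx =>
    left_ne_zero_of_smul (hkf x hx ▸ hk.ne_zero hx (hS x hx))
  exact ⟨_, R.isRepBeta_smul (hf.inv₀ hf0) fun x hx => inv_ne_zero (hf0 x hx),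
    fun x hx B B' => hk.tildeS_inv_smul hf hkf hx (hf0 x hx) B B'⟩

end ScaledReps

theorem IsSesquiWalker.isIntegrableOn_distH_iff {Z W : Distribution M} (h : IsSesquiWalker g Z W)
    (hU : IsOpen U) :
    IsIntegrableOn (distH g Z W) U ↔ IsAutoParallelOn g (distH g Z W) U := by
  refine ⟨fun hH => isAutoParallelOn_of_locally fun x _ => ?_, fun hH => hH.isIntegrableOn⟩
  obtain ⟨R, hxR⟩ := h.pair x
  have hZ : IsParallelOn g Z (R.dom ∩ U) := h.parallel.mono (Set.subset_univ _)
  exact ⟨R.dom, R.isOpen_dom, hxR, (R.restrict hU).isAutoParallelOn_distH hZ <|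
    ((R.restrict hU).isIntegrableOn_W_and_distH_iff hZ).1
      ⟨h.integrable.mono (Set.subset_univ _), hH.mono Set.inter_subset_right⟩⟩

end Distributions

end AlphaBeta

end

theorem lemma2p3 {M : Type*} [TopologicalSpace M] [ChartedSpace AlphaBeta.E4 M]
    [IsManifold (𝓡 4) ∞ M] (g : AlphaBeta.NeutralMetric M) (Z W : AlphaBeta.Distribution M) :
    -- Walker geometry with a β-distribution, on any union of domains of scaled representatives
    (AlphaBeta.IsWalkerWithBeta g Z W → ∀ Rs : Set (AlphaBeta.ScaledReps g Z W),
      (AlphaBeta.IsIntegrableOn W (⋃ R ∈ Rs, R.dom) ∧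
        AlphaBeta.IsIntegrableOn (AlphaBeta.distH g Z W) (⋃ R ∈ Rs, R.dom)) ↔
      ∀ R ∈ Rs, ∃ f : M → ℝ, ∀ x ∈ R.dom, ∀ B B',
        R.e.tildeS g R.l x B B' =
          f x * (AlphaBeta.lower (R.l x) B * AlphaBeta.lower (R.p x) B')) ∧
    (AlphaBeta.IsSesquiWalker g Z W →
      -- the spinor κ exists for all scaled representatives
      (∀ R : AlphaBeta.ScaledReps g Z W, ∃ k, R.IsKappa k) ∧
      -- 𝓗 is integrable iff π^{B'} κ_{B'} = 0
      (∀ (Rs : Set (AlphaBeta.ScaledReps g Z W))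
        (k : AlphaBeta.ScaledReps g Z W → M → Fin 2 → ℝ), (∀ R ∈ Rs, R.IsKappa (k R)) →
        (AlphaBeta.IsIntegrableOn (AlphaBeta.distH g Z W) (⋃ R ∈ Rs, R.dom) ↔
          ∀ R ∈ Rs, ∀ x ∈ R.dom, ∑ B', R.p x B' * AlphaBeta.lower (k R x) B' = 0)) ∧
      -- i.e. κ is a smooth multiple of π, and a scaled representative where it has no zero
      (∀ (R : AlphaBeta.ScaledReps g Z W) (k : M → Fin 2 → ℝ), R.IsKappa k →
        (AlphaBeta.IsIntegrableOn (AlphaBeta.distH g Z W) R.dom ↔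
          ∃ f : M → ℝ, AlphaBeta.SmoothFn f R.dom ∧ ∀ x ∈ R.dom, k x = f x • R.p x) ∧
        ((∀ x ∈ R.dom, k x ≠ 0) →
          (AlphaBeta.IsIntegrableOn (AlphaBeta.distH g Z W) R.dom ↔
            AlphaBeta.IsRepAlpha R.e R.dom Z k))) ∧
      -- either representative can be rescaled, the other being given
      (∀ R : AlphaBeta.ScaledReps g Z W,
        AlphaBeta.IsIntegrableOn (AlphaBeta.distH g Z W) R.dom →
        (∀ x ∈ R.dom, R.e.tildeS g R.l x ≠ 0) →
        (∃ p : M → Fin 2 → ℝ, AlphaBeta.IsRepAlpha R.e R.dom Z p ∧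
          ∀ x ∈ R.dom, ∀ B B', R.e.tildeS g R.l x B B' =
            AlphaBeta.lower (R.l x) B * AlphaBeta.lower (p x) B') ∧
        (∃ l : M → Fin 2 → ℝ, AlphaBeta.IsRepBeta R.e R.dom W l ∧
          ∀ x ∈ R.dom, ∀ B B', R.e.tildeS g l x B B' =
            AlphaBeta.lower (l x) B * AlphaBeta.lower (R.p x) B')) ∧
      -- 𝓗 is integrable iff it is auto-parallel
      (∀ U : Set M, IsOpen U →
        (AlphaBeta.IsIntegrableOn (AlphaBeta.distH g Z W) U ↔
          AlphaBeta.IsAutoParallelOn g (AlphaBeta.distH g Z W) U))) := by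
  refine ⟨fun h Rs => ?_, fun h => ?_⟩
  · rw [AlphaBeta.isIntegrableOn_biUnion fun R _ => R.isOpen_dom,
      AlphaBeta.isIntegrableOn_biUnion fun R _ => R.isOpen_dom, ← forall₂_and]
    exact forall₂_congr fun R _ =>
      R.isIntegrableOn_W_and_distH_iff_exists (h.parallel.mono (Set.subset_univ _))
  have hZ : ∀ R : AlphaBeta.ScaledReps g Z W, AlphaBeta.IsParallelOn g Z R.dom := fun R =>
    h.parallel.mono (Set.subset_univ _)
  have hW : ∀ R : AlphaBeta.ScaledReps g Z W, AlphaBeta.IsIntegrableOn W R.dom := fun R =>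
    h.integrable.mono (Set.subset_univ _)
  refine ⟨fun R => ⟨_, R.isKappa_kappa (hW R)⟩, fun Rs k hk => ?_, fun R k hk => ?_,
    fun R hH hS => ⟨R.exists_isRepAlpha_tildeS_eq (hZ R) (hW R) hH hS,
      R.exists_isRepBeta_tildeS_eq (hZ R) (hW R) hH hS⟩, fun U hU => h.isIntegrableOn_distH_iff hU⟩
  · simp only [AlphaBeta.sum_lower_mul]
    rw [AlphaBeta.isIntegrableOn_biUnion fun R _ => R.isOpen_dom]
    exact forall₂_congr fun R hR =>
      ((hk R hR).isIntegrableOn_distH_iff (hZ R) (hW R)).trans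
        (forall₂_congr fun _ _ => by rw [AlphaBeta.contract_swap, neg_eq_zero])
  · rw [hk.isIntegrableOn_distH_iff (hZ R) (hW R)]
    exact ⟨R.forall_contract_eq_zero_iff_exists_smul hk.smooth,
      R.forall_contract_eq_zero_iff_isRepAlpha hk.smooth⟩
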